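/- **Definitions.** A *Lévy exponent* is a continuous $f:\mathbb R\to\mathbb C$ with $f(0)=0$ such that $e^{f}$ is the characteristic function of an infinitely divisible law on $\mathbb R$. Its *Lévy triplet* $(\mu,\sigma^2,V)$ consists of $\mu\in\mathbb R$, $\sigma^2\ge 0$ and a measure $V$ on $\mathbb R$ with $V(\{0\})=0$ and $\int\min(1,t^2)\,V(dt)<\infty$ such that $$f(\xi)=\mathrm i\mu\xi-\frac{\sigma^2\xi^2}{2}+\int_{\mathbb R}\bigl(e^{\mathrm i\xi t}-1-\mathrm i\xi t\,1_{|t|\le 1}\bigr)V(dt).$$ It satisfies the *Schwartz condition* if $\int_{|t|\ge1}|t|^{\epsilon}V(dt)<\infty$ for some $\epsilon>0$. It is a *$(p_{\min},p_{\max})$-exponent* if there are $p_{\min}\le p\le q\le p_{\max}$ with $\int_{|t|\ge 1}|t|^pV(dt)<\infty$, $\int_{|t|<1}|t|^qV(dt)<\infty$, $p_{\min}=\min(p,1)$ if $V$ is not symmetric or $\mu\ne0$, and $p_{\max}=2$ if $\sigma^2\neq0$. A *Lévy white noise* with exponent $f$ (a Lévy exponent satisfying the Schwartz condition) is a random element $w$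 of $\mathcal S'(\mathbb R^d)$ (real tempered distributions with the cylindrical $\sigma$-field) with $\mathbb E[e^{\mathrm i\langle w,\varphi\rangle}]=\exp\bigl(\int_{\mathbb R^d}f(\varphi(x))\,dx\bigr)$ for all $\varphi\in\mathcal S(\mathbb R^d)$. An *impulsive noise* with rate $\lambda>0$ and jump law $J$ (a probability law on $\mathbb R$ with $\int|t|^{\epsilon}J(dt)<\infty$ for some $\epsilon>0$; an atom of $J$ at $0$ is allowed and contributes nothing to the noise) is a random element $w$ of $\mathcal S'(\mathbb R^d)$ with $\mathbb E[e^{\mathrm i\langle w,\varphi\rangle}]=\exp\bigl(\lambda\int_{\mathbb R^d}\int_{\mathbb R}(e^{\mathrm i\varphi(x)t}-1)\,J(dt)\,dx\bigr)$. A continuous linear $\mathrm L:\mathcal S(\mathbb R^d)\to\mathcal S'(\mathbb R^d)$ is *spline-admissible* if it is shift-invariant and has a Green's function, that is, a measurable function $\rho$ of slow growth (meaning $\int_{\mathbb R^d} |\rho(x)|(1+\|x\|)^{-N}dx<\infty$ for some $N$) with $\mathrm L\{\rho\}=\delta$, in the sense that each $\mathrm L^*\varphi$, $\varphi\in\mathcal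 S(\mathbb R^d)$, is a function with $\rho\,\mathrm L^*\varphi\in L_1(\mathbb R^d)$ and $\int\rho\,\mathrm L^*\varphi=\varphi(0)$; here $\langle\mathrm L^*\varphi,\psi\rangle=\langle\mathrm L\psi,\varphi\rangle$. For a spline-admissible $\mathrm L$ and a Lévy white noise $w$ with exponent $f$, the pair $(\mathrm L,w)$ is *compatible* if there are $0<p_{\min}\le p_{\max}\le2$ such that $f$ is a $(p_{\min},p_{\max})$-exponent and there is a linear operator $\mathrm T$, defined on a linear space of tempered distributions containing $\mathcal S(\mathbb R^d)$ and $\mathrm L^*(\mathcal S(\mathbb R^d))$, with $\mathrm T\mathrm L^*\varphi=\varphi$ for all $\varphi\in\mathcal S(\mathbb R^d)$, and whose restriction to $\mathcal S(\mathbb R^d)$ is continuous into $L_{p_{\min}}(\mathbb R^d)\cap L_{p_{\max}}(\mathbb R^d)$. **Statement.** Let $(\mathrm L,w)$ be compatible, where $\mathrm L$ is a spline-admissible operator and $w$ is a Lévy white noise with Lévy exponent $f$. Let $\lambda>0$ and $\tau>0$. Then there is a (unique) infinitely divisible law $Q$ on $\mathbb R$ with characteristic function $e^{\tau f}$. Let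 $J$ be either $Q$ or the compound Poisson law with rate $1$ and law of jumps $Q$ (whose characteristic function is $e^{e^{\tau f}-1}$). Then $\int|t|^\epsilon J(dt)<\infty$ for some $\epsilon>0$; the function $\lambda(\widehat J-1)$, where $\widehat J$ is the characteristic function of $J$, is a Lévy exponent that satisfies the Schwartz condition and, together with $\mathrm L$, the conditions of compatibility; and $(\mathrm L,w')$ is compatible for every impulsive noise $w'$ with rate $\lambda$ and jump law $J$, the Lévy exponent of $w'$ being $\lambda(\widehat J-1)$. -/

import Mathlib

open MeasureTheory Filter Topology
open scoped SchwartzMap ENNReal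

noncomputable section

namespace LevyCompat

/-! ### Laws on the real line and Lévy exponents -/

/-- The law of the sum of `n` i.i.d. real random variables with common law `ν`. -/
def iidSumLaw (ν : Measure ℝ) (n : ℕ) : Measure ℝ :=
  (Measure.pi (fun _ : Fin n => ν)).map (fun x => ∑ i, x i)

/-- A law on `ℝ` is infinitely divisible if for all `n ≥ 1` it is the law of a sum of
`n` i.i.d. random variables. -/
def IsInfinitelyDivisible (P : Measure ℝ) : Prop :=
  IsProbabilityMeasure P ∧
    ∀ n : ℕ, 1 ≤ n → ∃ ν : Measure ℝ, IsProbabilityMeasure ν ∧ iidSumLaw ν n = P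

/-- `P` is the infinitely divisible law with characteristic function `exp f`
(by injectivity of the characteristic function there is at most one such `P`). -/
def IsInfDivLaw (f : ℝ → ℂ) (P : Measure ℝ) : Prop :=
  IsInfinitelyDivisible P ∧ ∀ ξ : ℝ, charFun P ξ = Complex.exp (f ξ)

/-- A Lévy exponent: the continuous logarithm (normalised to vanish at `0`) of the characteristic
function of an infinitely divisible law. -/
def IsLevyExponent (f : ℝ → ℂ) : Prop :=
  Continuous f ∧ f 0 = 0 ∧ ∃ P : Measure ℝ, IsInfDivLaw f P

/-- The compound Poisson law with rate `r` and law of jumps `Q`: the law of `X₁ + ⋯ + X_N`, with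
`N` Poisson of parameter `r` and the `Xᵢ` i.i.d. of law `Q`, independent of `N`. -/
def compoundPoissonLaw (r : ℝ) (Q : Measure ℝ) : Measure ℝ :=
  Measure.sum fun n : ℕ =>
    ENNReal.ofReal (Real.exp (-r) * r ^ n / n.factorial) • iidSumLaw Q n

/-- A Lévy measure on `ℝ`. -/
def IsLevyMeasure (V : Measure ℝ) : Prop :=
  ∫⁻ t, ENNReal.ofReal (min 1 (t ^ 2)) ∂V < ∞ ∧ V {0} = 0

/-- `(m, s, V)` (with `s` in the role of `σ²`) is the Lévy triplet of `f`. -/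
def IsLevyTriplet (m s : ℝ) (V : Measure ℝ) (f : ℝ → ℂ) : Prop :=
  0 ≤ s ∧ IsLevyMeasure V ∧
    ∀ ξ : ℝ, f ξ = Complex.I * m * ξ - s * ξ ^ 2 / 2 +
      ∫ t : ℝ, (Complex.exp (Complex.I * ξ * t) - 1
        - Complex.I * ξ * ({u : ℝ | |u| ≤ 1}.indicator (fun u => u) t : ℝ)) ∂V

/-- `∫_{|t| ≥ 1} |t|ᵖ V(dt) < ∞`. -/
def FiniteTailMoment (p : ℝ) (V : Measure ℝ) : Prop :=
  ∫⁻ t in {t : ℝ | 1 ≤ |t|}, ENNReal.ofReal (|t| ^ p) ∂V < ∞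

/-- `∫_{|t| < 1} |t|^q V(dt) < ∞`. -/
def FiniteLocalMoment (q : ℝ) (V : Measure ℝ) : Prop :=
  ∫⁻ t in {t : ℝ | |t| < 1}, ENNReal.ofReal (|t| ^ q) ∂V < ∞

/-- A Lévy exponent satisfying the Schwartz condition. -/
def IsSchwartzLevyExponent (f : ℝ → ℂ) : Prop :=
  IsLevyExponent f ∧
    ∃ (m s : ℝ) (V : Measure ℝ), IsLevyTriplet m s V f ∧ ∃ ε : ℝ, 0 < ε ∧ FiniteTailMoment ε V

/-- `V` is symmetric. -/
def IsSymmetricMeasure (V : Measure ℝ) : Prop :=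
  V.map (fun t => -t) = V

/-- `(m, s, V)` (with `s` in the role of `σ²`) is a `(pmin, pmax)`-triplet. -/
def IsPTriplet (pmin pmax m s : ℝ) (V : Measure ℝ) : Prop :=
  ∃ p q : ℝ, pmin ≤ p ∧ p ≤ q ∧ q ≤ pmax ∧
    FiniteTailMoment p V ∧ FiniteLocalMoment q V ∧
    ((¬ IsSymmetricMeasure V ∨ m ≠ 0) → pmin = min p 1) ∧
    (s ≠ 0 → pmax = 2)

/-- `f` is a `(pmin, pmax)`-exponent. -/
def IsPExponent (pmin pmax : ℝ) (f : ℝ → ℂ) : Prop :=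
  ∃ (m s : ℝ) (V : Measure ℝ), IsLevyTriplet m s V f ∧ IsPTriplet pmin pmax m s V

/-! ### Tempered distributions and spline-admissible operators -/

/-- `ℝᵈ` with its Euclidean norm. -/
abbrev Rd (d : ℕ) : Type := EuclideanSpace ℝ (Fin d)

/-- The real Schwartz space `𝒮(ℝᵈ)`. -/
abbrev Sch (d : ℕ) : Type := 𝓢(Rd d, ℝ)

/-- The space `𝒮'(ℝᵈ)` of real tempered distributions. -/
abbrev Temp (d : ℕ) : Type := Sch d →L[ℝ] ℝ

/-- The tempered distribution `ψ ↦ ∫ φ ψ` of a Schwartz function `φ`. -/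
def toTemp {d : ℕ} (φ : Sch d) : Temp d :=
  (SchwartzMap.integralCLM ℝ (volume : Measure (Rd d))).comp
    (SchwartzMap.pairing (ContinuousLinearMap.mul ℝ ℝ) φ)

theorem toTemp_apply {d : ℕ} (φ ψ : Sch d) : toTemp φ ψ = ∫ x, φ x * ψ x := rfl

/-- The adjoint `L* : 𝒮(ℝᵈ) → 𝒮'(ℝᵈ)` of `L`, given by `⟨L* φ, ψ⟩ = ⟨L ψ, φ⟩`. -/
def adj {d : ℕ} (L : Sch d →L[ℝ] Temp d) (φ : Sch d) : Temp d where
  toFun ψ := L ψ φ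
  map_add' ψ₁ ψ₂ := by simp
  map_smul' c ψ := by simp
  cont := (continuous_eval_const φ).comp L.continuous

theorem adj_apply {d : ℕ} (L : Sch d →L[ℝ] Temp d) (φ ψ : Sch d) : adj L φ ψ = L ψ φ := rfl

/-- The translate `φ(· - a)`. -/
def shift {d : ℕ} (a : Rd d) (φ : Sch d) : Sch d :=
  SchwartzMap.compSubConstCLM ℝ a φ

/-- `L{φ(· - a)} = L{φ}(· - a)`, where `⟨u(· - a), ψ⟩ = ⟨u, ψ(· + a)⟩` for `u ∈ 𝒮'(ℝᵈ)`. -/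
def IsShiftInvariant {d : ℕ} (L : Sch d →L[ℝ] Temp d) : Prop :=
  ∀ (a : Rd d) (φ ψ : Sch d), L (shift a φ) ψ = L φ (shift (-a) ψ)

/-- The tempered distribution `u` is the function `g`, that is `⟨u, ψ⟩ = ∫ g ψ`. -/
def IsRepresentedBy {d : ℕ} (u : Temp d) (g : Rd d → ℝ) : Prop :=
  ∀ ψ : Sch d, Integrable (fun x => g x * ψ x) ∧ u ψ = ∫ x, g x * ψ x

/-- A measurable function of slow growth (in the integral sense, so that local singularities such
as those of `log ‖x‖` are allowed). -/
def IsSlowGrowth {d : ℕ} (ρ : Rd d → ℝ) : Prop :=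
  Measurable ρ ∧ ∃ N : ℕ, Integrable (fun x => ρ x / (1 + ‖x‖) ^ N)

/-- `ρ` is a Green's function of `L`: `L{ρ} = δ`, understood by duality as
`⟨ρ, L* φ⟩ = φ(0)` for all `φ ∈ 𝒮(ℝᵈ)`. -/
def IsGreenFunction {d : ℕ} (L : Sch d →L[ℝ] Temp d) (ρ : Rd d → ℝ) : Prop :=
  ∀ φ : Sch d, ∃ g : Rd d → ℝ, IsRepresentedBy (adj L φ) g ∧
    Integrable (fun x => ρ x * g x) ∧ ∫ x, ρ x * g x = φ 0

/-- Spline-admissible operators. -/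
def IsSplineAdmissible {d : ℕ} (L : Sch d →L[ℝ] Temp d) : Prop :=
  IsShiftInvariant L ∧ ∃ ρ : Rd d → ℝ, IsSlowGrowth ρ ∧ IsGreenFunction L ρ

/-! ### Generalized random processes and noises -/

/-- The cylindrical `σ`-field of `𝒮'(ℝᵈ)`. -/
@[reducible] def cylindrical (d : ℕ) : MeasurableSpace (Temp d) :=
  MeasurableSpace.generateFrom
    {A | ∃ (N : ℕ) (φ : Fin N → Sch d) (B : Set (Fin N → ℝ)),
      MeasurableSet B ∧ A = {v : Temp d | (fun i => v (φ i)) ∈ B}}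

/-- `w` is a generalized random process on the probability space `(Ω, μ)`. -/
def IsGeneralizedProcess {d : ℕ} {Ω : Type*} [MeasurableSpace Ω] (μ : Measure Ω)
    (w : Ω → Temp d) : Prop :=
  IsProbabilityMeasure μ ∧ Measurable[_, cylindrical d] w

/-- The characteristic functional `φ ↦ 𝔼[exp(i⟨w, φ⟩)]`. -/
def charFunctional {d : ℕ} {Ω : Type*} [MeasurableSpace Ω] (μ : Measure Ω)
    (w : Ω → Temp d) (φ : Sch d) : ℂ :=
  ∫ ω, Complex.exp (Complex.I * (w ω φ : ℝ)) ∂μ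

/-- `w` is a Lévy white noise with Lévy exponent `f`. -/
def IsLevyWhiteNoise {d : ℕ} {Ω : Type*} [MeasurableSpace Ω] (μ : Measure Ω)
    (w : Ω → Temp d) (f : ℝ → ℂ) : Prop :=
  IsGeneralizedProcess μ w ∧ IsSchwartzLevyExponent f ∧
    ∀ φ : Sch d, charFunctional μ w φ = Complex.exp (∫ x, f (φ x))

/-- `J` is a probability law with `∫ |t|^ε J(dt) < ∞` for some `ε > 0`. -/
def IsJumpLaw (J : Measure ℝ) : Prop :=
  IsProbabilityMeasure J ∧ ∃ ε : ℝ, 0 < ε ∧ ∫⁻ t, ENNReal.ofReal (|t| ^ ε) ∂J < ∞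

/-- `w` is an impulsive noise with rate `r` and law of jumps `J`. The law `J` may have an atom
at `0`; the jumps equal to `0` do not contribute to the noise. -/
def IsImpulsiveNoise {d : ℕ} {Ω : Type*} [MeasurableSpace Ω] (μ : Measure Ω)
    (w : Ω → Temp d) (r : ℝ) (J : Measure ℝ) : Prop :=
  IsGeneralizedProcess μ w ∧ 0 < r ∧ IsJumpLaw J ∧
    ∀ φ : Sch d, charFunctional μ w φ =
      Complex.exp (r * ∫ x : Rd d, ∫ t : ℝ, (Complex.exp (Complex.I * (φ x : ℝ) * t) - 1) ∂J)

/-- The Lévy exponent `r (Ĵ - 1)` of the impulsive noise with rate `r` and law of jumps `J`. -/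
def impulsiveExponent (r : ℝ) (J : Measure ℝ) (ξ : ℝ) : ℂ :=
  r * (charFun J ξ - 1)

/-! ### Compatibility -/

/-- `U : 𝒮(ℝᵈ) → L^p(ℝᵈ)` is well defined and continuous. For `0 < p < 1` the topology of `L^p` is
that of the metric `‖u - v‖_p^p`. -/
def IsContinuousToLp {d : ℕ} (p : ℝ) (U : Sch d →ₗ[ℝ] (Rd d →ₘ[volume] ℝ)) : Prop :=
  (∀ φ : Sch d, MemLp (U φ) (ENNReal.ofReal p) volume) ∧
    ∀ φ : Sch d, Tendsto (fun ψ : Sch d => eLpNorm (U ψ - U φ : Rd d →ₘ[volume] ℝ)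
      (ENNReal.ofReal p) volume) (𝓝 φ) (𝓝 0)

/-- The adjoint of `L` has a left inverse `T` that is linear and continuous from `𝒮(ℝᵈ)` to
`L^pmin(ℝᵈ) ∩ L^pmax(ℝᵈ)`. The domain of `T` is a linear space of tempered distributions that
contains both `𝒮(ℝᵈ)` and the range of `L*`, and `U` is the restriction of `T` to `𝒮(ℝᵈ)`. -/
def HasStableLeftInverse {d : ℕ} (L : Sch d →L[ℝ] Temp d) (pmin pmax : ℝ) : Prop :=
  ∃ (T : Temp d →ₗ.[ℝ] (Rd d →ₘ[volume] ℝ)) (U : Sch d →ₗ[ℝ] (Rd d →ₘ[volume] ℝ)),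
    (∀ φ : Sch d, ∃ h : adj L φ ∈ T.domain,
      T ⟨adj L φ, h⟩ = AEEqFun.mk φ φ.continuous.aestronglyMeasurable) ∧
    (∀ φ : Sch d, ∃ h : toTemp φ ∈ T.domain, T ⟨toTemp φ, h⟩ = U φ) ∧
    IsContinuousToLp pmin U ∧ IsContinuousToLp pmax U

/-- The two conditions for the compatibility of `L` with a noise of Lévy exponent `f`. -/
def CompatibilityConditions {d : ℕ} (L : Sch d →L[ℝ] Temp d) (f : ℝ → ℂ) : Prop :=
  ∃ pmin pmax : ℝ, 0 < pmin ∧ pmin ≤ pmax ∧ pmax ≤ 2 ∧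
    IsPExponent pmin pmax f ∧ HasStableLeftInverse L pmin pmax

/-- `L` is spline-admissible, `w` is a Lévy white noise with Lévy exponent `f`, and `(L, w)` is
compatible. -/
def IsCompatible {d : ℕ} {Ω : Type*} [MeasurableSpace Ω] (L : Sch d →L[ℝ] Temp d)
    (μ : Measure Ω) (w : Ω → Temp d) (f : ℝ → ℂ) : Prop :=
  IsSplineAdmissible L ∧ IsLevyWhiteNoise μ w f ∧ CompatibilityConditions L f

end LevyCompat

end

/-!
Let `(m, s, V)` be a triplet of `f` and `pmin ≤ pmax` the orders for which `(L, w)` is compatible.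

The law `Q` with characteristic function `exp (τ f)` is the limit of integer convolution powers of
convolution roots of the law of `f`, by Lévy's continuity theorem
(`existsUnique_isInfDivLaw_mul`).

For a probability law `J` the function `λ (Ĵ - 1)` has drift `λ ∫_{|t| ≤ 1} t J(dt)`, no Gaussian
part, and the finite Lévy measure `λ J` without its atom at `0`
(`isLevyTriplet_impulsiveExponent`). Such a Lévy measure has a local moment of every nonnegative
order, so the same pair `(pmin, pmax)` serves for `λ (Ĵ - 1)`, with the same left inverse of `L*`,
once `∫ |t|^pmin J(dt) < ∞` and either `pmin ≤ 1` or `J` is symmetric (`IsAdmissibleJumpLaw`). If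
`V` is not symmetric or `m ≠ 0`, then `pmin = min p 1 ≤ 1`; otherwise `f` is real, hence so is the
characteristic function of `Q`, and `Q` is symmetric.

What remains is that a tail moment of the Lévy measure of order `p = pmin ≤ 2` gives a moment of
order `p` of the infinitely divisible law (`IsLevyTriplet.lintegral_rpow_lt_top`). For `p < 2` this
rests on the comparison of `∫₀¹ (1 - cos (ξ t)) ξ^(-1-p) dξ` with `|t|ᵖ` (`le_cosKernel`,
`cosKernel_le`): by Tonelli's theorem, a moment of order `p` is finite as soon as `1 - Re φ(ξ)` is
integrable against `ξ^(-1-p)` on `(0, 1)`, and for `φ = exp (τ f)` one has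
`1 - Re φ ≤ -τ Re f + (τ Im f)² / 2`. The first term is handled by the upper bound of the kernel,
applied to `V`; the second vanishes in the symmetric case and is `O(ξ^(2p))` if `p ≤ 1`. For `p = 2`
the bound `1 - Re φ(ξ) = O(ξ²)` and Fatou's lemma suffice.

The compound Poisson law with jumps `Q` is itself infinitely divisible, with exponent `Q̂ - 1`, so
its moments follow by a second application of the same criterion.
-/

namespace LevyCompat

/-! ### Characteristic functions of sums and of compound Poisson laws -/

instance isProbabilityMeasure_iidSumLaw (ν : Measure ℝ) [IsProbabilityMeasure ν] (n : ℕ) :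
    IsProbabilityMeasure (iidSumLaw ν n) :=
  Measure.isProbabilityMeasure_map (by fun_prop)

theorem charFun_iidSumLaw (ν : Measure ℝ) [IsProbabilityMeasure ν] (n : ℕ) (ξ : ℝ) :
    charFun (iidSumLaw ν n) ξ = charFun ν ξ ^ n := by
  simp [iidSumLaw, ProbabilityTheory.charFun_map_sum_pi_eq_prod]

theorem hasSum_poissonWeight (r : ℝ) :
    HasSum (fun n : ℕ => Real.exp (-r) * r ^ n / n.factorial) 1 := by
  have h := (NormedSpace.expSeries_div_hasSum_exp (𝔸 := ℝ) r).mul_left (Real.exp (-r))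
  rw [← Real.exp_eq_exp_ℝ, ← Real.exp_add, neg_add_cancel, Real.exp_zero] at h
  simpa [mul_div_assoc] using h

theorem isProbabilityMeasure_compoundPoissonLaw {r : ℝ} (hr : 0 ≤ r) (Q : Measure ℝ)
    [IsProbabilityMeasure Q] : IsProbabilityMeasure (compoundPoissonLaw r Q) := by
  refine ⟨?_⟩
  rw [compoundPoissonLaw, Measure.sum_apply _ MeasurableSet.univ]
  simp only [Measure.smul_apply, measure_univ, smul_eq_mul, mul_one]
  rw [← ENNReal.ofReal_tsum_of_nonneg (fun n => by positivity) (hasSum_poissonWeight r).summable,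
    (hasSum_poissonWeight r).tsum_eq, ENNReal.ofReal_one]

theorem charFun_compoundPoissonLaw {r : ℝ} (hr : 0 ≤ r) (Q : Measure ℝ) [IsProbabilityMeasure Q]
    (ξ : ℝ) : charFun (compoundPoissonLaw r Q) ξ = Complex.exp (r * (charFun Q ξ - 1)) := by
  have := isProbabilityMeasure_compoundPoissonLaw hr Q
  have hint : Integrable (fun x : ℝ => Complex.exp (ξ * x * Complex.I))
      (compoundPoissonLaw r Q) := by
    refine (integrable_const (1 : ℝ)).mono' (by fun_prop) (.of_forall fun x => ?_)
    rw [← Complex.ofReal_mul, Complex.norm_exp_ofReal_mul_I]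
  have h1 := hasSum_integral_measure hint
  have h2 := (NormedSpace.expSeries_div_hasSum_exp (𝔸 := ℂ) (r * charFun Q ξ)).mul_left
    (Complex.exp (-r))
  rw [← Complex.exp_eq_exp_ℂ, ← Complex.exp_add] at h2
  have hterm (n : ℕ) : ∫ x : ℝ, Complex.exp (ξ * x * Complex.I)
        ∂(ENNReal.ofReal (Real.exp (-r) * r ^ n / n.factorial) • iidSumLaw Q n) =
      Complex.exp (-r) * ((r * charFun Q ξ) ^ n / n.factorial) := by
    rw [integral_smul_measure, ← charFun_apply_real, charFun_iidSumLaw,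
      ENNReal.toReal_ofReal (by positivity), Complex.real_smul]
    push_cast
    ring
  simp only [hterm] at h1
  rw [charFun_apply_real, compoundPoissonLaw, h1.unique h2]
  congr 1
  ring

theorem isInfinitelyDivisible_compoundPoissonLaw {r : ℝ} (hr : 0 ≤ r) (Q : Measure ℝ)
    [IsProbabilityMeasure Q] : IsInfinitelyDivisible (compoundPoissonLaw r Q) := by
  have := isProbabilityMeasure_compoundPoissonLaw hr Q
  refine ⟨this, fun n hn => ?_⟩
  have hrn : 0 ≤ r / n := by positivity
  have hν := isProbabilityMeasure_compoundPoissonLaw hrn Q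
  refine ⟨compoundPoissonLaw (r / n) Q, hν, Measure.ext_of_charFun (funext fun ξ => ?_)⟩
  have hn' : (n : ℂ) ≠ 0 := by exact_mod_cast (by omega : n ≠ 0)
  rw [charFun_iidSumLaw, charFun_compoundPoissonLaw hrn, charFun_compoundPoissonLaw hr,
    ← Complex.exp_nat_mul]
  congr 1
  push_cast
  field_simp

/-! ### Real convolution powers of an infinitely divisible law -/

/-- The characteristic function of an `n`-th convolution root is `exp (f / n)`: both are continuous
`n`-th roots of `exp f` that agree at `0`, and their quotient is continuous on the line with values
in the finite set of `n`-th roots of unity. -/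
theorem exists_charFun_eq_exp_div {f : ℝ → ℂ} (hf : Continuous f) (hf0 : f 0 = 0) {P : Measure ℝ}
    (hP : IsInfDivLaw f P) {n : ℕ} (hn : 1 ≤ n) :
    ∃ ν : Measure ℝ, IsProbabilityMeasure ν ∧ ∀ ξ, charFun ν ξ = Complex.exp (f ξ / n) := by
  obtain ⟨ν, hν, hνP⟩ := hP.1.2 n hn
  refine ⟨ν, hν, fun ξ => ?_⟩
  have hn' : (n : ℂ) ≠ 0 := by exact_mod_cast (by omega : n ≠ 0)
  have hpow (x : ℝ) : (charFun ν x * Complex.exp (-(f x / n))) ^ n = 1 := by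
    rw [mul_pow, ← charFun_iidSumLaw, hνP, hP.2, ← Complex.exp_nat_mul, ← Complex.exp_add,
      mul_neg, mul_div_cancel₀ _ hn', add_neg_cancel, Complex.exp_zero]
  have hfin : {z : ℂ | z ^ n = 1}.Finite := by
    refine (Polynomial.nthRoots n (1 : ℂ)).toFinset.finite_toSet.subset fun z hz => ?_
    simpa [Polynomial.mem_nthRoots (by omega : 0 < n)] using hz
  have hconst := isPreconnected_univ.constant_of_mapsTo hfin.isDiscrete
    (f := fun x : ℝ => charFun ν x * Complex.exp (-(f x / n)))
    (Continuous.continuousOn (by fun_prop)) (fun x _ => hpow x) (Set.mem_univ ξ) (Set.mem_univ 0)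
  simp only [hf0, zero_div, neg_zero, Complex.exp_zero, charFun_zero, probReal_univ,
    Complex.ofReal_one, mul_one] at hconst
  rwa [Complex.exp_neg, mul_inv_eq_one₀ (Complex.exp_ne_zero _)] at hconst

/-- **Lévy's continuity theorem**, existence part: a pointwise limit of characteristic functions
that is continuous at `0` is a characteristic function. -/
theorem exists_charFun_eq_of_tendsto {μ : ℕ → Measure ℝ} [hμ : ∀ n, IsProbabilityMeasure (μ n)]
    {φ : ℝ → ℂ} (hφ : ContinuousAt φ 0)
    (h : ∀ ξ, Tendsto (fun n => charFun (μ n) ξ) atTop (𝓝 (φ ξ))) :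
    ∃ P : Measure ℝ, IsProbabilityMeasure P ∧ ∀ ξ, charFun P ξ = φ ξ := by
  let μ' : ℕ → ProbabilityMeasure ℝ := fun n => ⟨μ n, hμ n⟩
  have htight := isTightMeasureSet_of_tendsto_charFun hφ h
  have hcompact : IsCompact (closure (Set.range μ')) := by
    refine isCompact_closure_of_isTightMeasureSet ?_
    convert! htight
    ext m
    exact ⟨fun ⟨_, ⟨n, hn⟩, hm⟩ => ⟨n, by rw [← hm, ← hn]; rfl⟩,
      fun ⟨n, hn⟩ => ⟨μ' n, ⟨n, rfl⟩, hn⟩⟩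
  let U : Ultrafilter ℕ := Ultrafilter.of atTop
  have hU : (U : Filter ℕ) ≤ atTop := Ultrafilter.of_le _
  obtain ⟨P, -, hP : Tendsto _ _ _⟩ := hcompact.ultrafilter_le_nhds (U.map μ')
    (.trans (by simp) (monotone_principal subset_closure))
  refine ⟨P, inferInstance, fun ξ => ?_⟩
  refine tendsto_nhds_unique (f := fun n => charFun (μ n) ξ) (l := (U : Filter ℕ)) ?_
    ((h ξ).mono_left hU)
  rw [ProbabilityMeasure.tendsto_iff_forall_integral_rclike_tendsto ℂ] at hP
  simp_rw [charFun_eq_integral_innerProbChar]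
  exact hP (BoundedContinuousFunction.innerProbChar ξ)

/-- The convolution powers `⌈τ(k + 1)⌉` of the `(k + 1)`-st convolution roots of `exp ∘ f` converge
to the law with characteristic function `exp (τ f)`. -/
theorem exists_charFun_eq_exp_mul {f : ℝ → ℂ} (hf : IsLevyExponent f) {τ : ℝ} (hτ : 0 ≤ τ) :
    ∃ Q : Measure ℝ, IsProbabilityMeasure Q ∧ ∀ ξ, charFun Q ξ = Complex.exp (τ * f ξ) := by
  obtain ⟨hcont, hf0, P, hP⟩ := hf
  choose ν hν hνf using fun k : ℕ => exists_charFun_eq_exp_div hcont hf0 hP (Nat.le_add_left 1 k)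
  have hμ (k : ℕ) : IsProbabilityMeasure (iidSumLaw (ν k) ⌈τ * ((k + 1 : ℕ) : ℝ)⌉₊) :=
    have := hν k
    inferInstance
  refine exists_charFun_eq_of_tendsto
    (μ := fun k : ℕ => iidSumLaw (ν k) ⌈τ * ((k + 1 : ℕ) : ℝ)⌉₊)
    (Continuous.continuousAt (by fun_prop)) fun ξ => ?_
  have h1 : Tendsto (fun k : ℕ => (⌈τ * ((k + 1 : ℕ) : ℝ)⌉₊ : ℝ) / ((k + 1 : ℕ) : ℝ)) atTop
      (𝓝 τ) :=
    (tendsto_nat_ceil_mul_div_atTop hτ).comp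
      (tendsto_natCast_atTop_atTop.comp (tendsto_add_atTop_nat 1))
  have h2 := (Complex.continuous_exp.tendsto (τ * f ξ)).comp
    (((Complex.continuous_ofReal.tendsto τ).comp h1).mul_const (f ξ))
  refine h2.congr fun k => ?_
  have := hν k
  rw [charFun_iidSumLaw, hνf, ← Complex.exp_nat_mul]
  simp only [Function.comp_apply]
  congr 1
  push_cast
  ring

theorem existsUnique_isInfDivLaw_mul {f : ℝ → ℂ} (hf : IsLevyExponent f) {τ : ℝ} (hτ : 0 ≤ τ) :
    ∃! Q : Measure ℝ, IsInfDivLaw (fun ξ => τ * f ξ) Q := by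
  obtain ⟨Q, hQ, hQf⟩ := exists_charFun_eq_exp_mul hf hτ
  refine ⟨Q, ⟨⟨hQ, fun n hn => ?_⟩, hQf⟩, fun Q' hQ' => ?_⟩
  · obtain ⟨ν, hν, hνf⟩ := exists_charFun_eq_exp_mul hf (div_nonneg hτ n.cast_nonneg)
    refine ⟨ν, hν, Measure.ext_of_charFun (funext fun ξ => ?_)⟩
    have hn' : (n : ℂ) ≠ 0 := by exact_mod_cast (by omega : n ≠ 0)
    rw [charFun_iidSumLaw, hνf, hQf, ← Complex.exp_nat_mul]
    congr 1
    push_cast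
    field_simp
  · have := hQ'.1.1
    exact Measure.ext_of_charFun (funext fun ξ => by rw [hQ'.2, hQf])

/-! ### Moments of a law and the behaviour of its characteristic function at the origin -/

/-- `∫₀¹ (1 - cos (ξ t)) ξ^(-1-p) dξ`, which is comparable to `|t|ᵖ` for `|t| ≥ 1` and
`0 < p < 2`. -/
noncomputable def cosKernel (p t : ℝ) : ℝ≥0∞ :=
  ∫⁻ ξ in Set.Ioo (0 : ℝ) 1, ENNReal.ofReal ((1 - Real.cos (ξ * t)) * ξ ^ (-1 - p))

theorem le_cosKernel {p t : ℝ} (hp : 0 < p) (ht : 1 ≤ |t|) :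
    ENNReal.ofReal (|t| ^ p) ≤ ENNReal.ofReal (4 * Real.pi ^ 2) * cosKernel p t := by
  have ht0 : 0 < |t| := one_pos.trans_le ht
  have hπ := Real.pi_gt_three
  -- on `(1 / (2 |t|), 1 / |t|)` the integrand is at least a constant
  have hmain : ENNReal.ofReal (1 / (2 * Real.pi ^ 2) * |t| ^ (1 + p)) *
      volume (Set.Ioo (1 / (2 * |t|)) (1 / |t|)) ≤ cosKernel p t := by
    rw [← setLIntegral_const]
    refine (setLIntegral_mono' measurableSet_Ioo fun ξ hξ => ?_).trans
      (lintegral_mono_set (Set.Ioo_subset_Ioo (by positivity) ((div_le_one ht0).2 ht)))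
    have hξ0 : 0 < ξ := lt_trans (by positivity) hξ.1
    have h1 : ξ * |t| < 1 := (lt_div_iff₀ ht0).1 hξ.2
    have h2 : 1 / 2 < ξ * |t| := by
      have := (div_lt_iff₀ (by positivity)).1 hξ.1
      linarith
    refine ENNReal.ofReal_le_ofReal (mul_le_mul ?_ ?_ (by positivity)
      (by linarith [Real.cos_le_one (ξ * t)]))
    · have habs : |ξ * t| = ξ * |t| := by rw [abs_mul, abs_of_pos hξ0]
      have h3 := Real.cos_le_one_sub_mul_cos_sq (x := ξ * t) (by rw [habs]; linarith)
      have h4 : 1 / 4 ≤ (ξ * t) ^ 2 := by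
        rw [← sq_abs, habs]
        nlinarith
      have h5 : 2 / Real.pi ^ 2 * (1 / 4) ≤ 2 / Real.pi ^ 2 * (ξ * t) ^ 2 := by gcongr
      have h6 : 2 / Real.pi ^ 2 * (1 / 4) = 1 / (2 * Real.pi ^ 2) := by field_simp; norm_num
      linarith
    · have h3 : |t| ≤ ξ⁻¹ := by
        rw [le_inv_comm₀ ht0 hξ0, ← one_div]
        exact hξ.2.le
      calc |t| ^ (1 + p) ≤ ξ⁻¹ ^ (1 + p) := Real.rpow_le_rpow ht0.le h3 (by linarith)
        _ = ξ ^ (-1 - p) := by rw [Real.inv_rpow hξ0.le, ← Real.rpow_neg hξ0.le]; ring_nf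
  refine le_trans (le_of_eq ?_) (mul_le_mul_right hmain _)
  rw [Real.volume_Ioo, ← ENNReal.ofReal_mul (by positivity), ← ENNReal.ofReal_mul (by positivity),
    Real.rpow_add ht0, Real.rpow_one]
  congr 1
  field_simp
  ring

theorem cosKernel_le {p : ℝ} (hp : 0 < p) (hp2 : p < 2) {t : ℝ} (ht : 1 ≤ |t|) :
    cosKernel p t ≤ ENNReal.ofReal (1 / (2 - p) + 2 / p) * ENNReal.ofReal (|t| ^ p) := by
  have ht0 : 0 < |t| := one_pos.trans_le ht
  set a : ℝ := 1 / |t| with ha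
  have ha0 : 0 < a := by positivity
  have hI1 : ∫⁻ ξ in Set.Ioc 0 a, ENNReal.ofReal ((1 - Real.cos (ξ * t)) * ξ ^ (-1 - p)) ≤
      ENNReal.ofReal (t ^ 2 * (a ^ (2 - p) / (2 - p))) := by
    have hint : IntervalIntegrable (fun ξ : ℝ => ξ ^ (1 - p)) volume 0 a :=
      intervalIntegral.intervalIntegrable_rpow' (by linarith)
    have hval : ∫ ξ in Set.Ioc 0 a, ξ ^ (1 - p) = a ^ (2 - p) / (2 - p) := by
      rw [← intervalIntegral.integral_of_le ha0.le, integral_rpow (Or.inl (by linarith)),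
        Real.zero_rpow (by linarith)]
      ring_nf
    rw [← hval, ENNReal.ofReal_mul (by positivity),
      ofReal_integral_eq_lintegral_ofReal ((intervalIntegrable_iff_integrableOn_Ioc_of_le ha0.le).1
        hint) ((ae_restrict_iff' measurableSet_Ioc).2 (.of_forall fun ξ hξ =>
          Real.rpow_nonneg hξ.1.le _)), ← lintegral_const_mul' _ _ ENNReal.ofReal_ne_top]
    refine setLIntegral_mono' measurableSet_Ioc fun ξ hξ => ?_
    rw [← ENNReal.ofReal_mul (by positivity)]
    refine ENNReal.ofReal_le_ofReal ?_
    have h1 := Real.one_sub_sq_div_two_le_cos (x := ξ * t)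
    have h2 : ξ ^ (1 - p) = ξ ^ 2 * ξ ^ (-1 - p) := by
      rw [← Real.rpow_natCast, ← Real.rpow_add hξ.1]
      norm_num
      ring_nf
    rw [h2, ← mul_assoc]
    have := Real.rpow_nonneg hξ.1.le (-1 - p)
    gcongr
    nlinarith [sq_nonneg (ξ * t)]
  have hI2 : ∫⁻ ξ in Set.Ioi a, ENNReal.ofReal ((1 - Real.cos (ξ * t)) * ξ ^ (-1 - p)) ≤
      ENNReal.ofReal (2 * (a ^ (-p) / p)) := by
    have hval : ∫ ξ in Set.Ioi a, ξ ^ (-1 - p) = a ^ (-p) / p := by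
      rw [integral_Ioi_rpow_of_lt (by linarith) ha0]
      rw [show -1 - p + 1 = -p by ring, neg_div_neg_eq]
    rw [← hval, ENNReal.ofReal_mul (by positivity),
      ofReal_integral_eq_lintegral_ofReal (integrableOn_Ioi_rpow_of_lt (by linarith) ha0)
        ((ae_restrict_iff' measurableSet_Ioi).2 (.of_forall fun ξ hξ =>
          Real.rpow_nonneg (ha0.trans hξ).le _)), ← lintegral_const_mul' _ _ ENNReal.ofReal_ne_top]
    refine setLIntegral_mono' measurableSet_Ioi fun ξ hξ => ?_
    rw [← ENNReal.ofReal_mul (by positivity)]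
    refine ENNReal.ofReal_le_ofReal (mul_le_mul_of_nonneg_right ?_
      (Real.rpow_nonneg (ha0.trans hξ).le _))
    linarith [Real.neg_one_le_cos (ξ * t)]
  calc cosKernel p t
      ≤ ∫⁻ ξ in Set.Ioc 0 a ∪ Set.Ioi a,
          ENNReal.ofReal ((1 - Real.cos (ξ * t)) * ξ ^ (-1 - p)) := by
        refine lintegral_mono_set fun ξ hξ => ?_
        rw [Set.Ioc_union_Ioi_eq_Ioi ha0.le]
        exact hξ.1
    _ ≤ ENNReal.ofReal (t ^ 2 * (a ^ (2 - p) / (2 - p))) + ENNReal.ofReal (2 * (a ^ (-p) / p)) :=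
        (lintegral_union_le _ _ _).trans (add_le_add hI1 hI2)
    _ = ENNReal.ofReal (1 / (2 - p) + 2 / p) * ENNReal.ofReal (|t| ^ p) := by
        have h2p : 0 < 2 - p := by linarith
        rw [← ENNReal.ofReal_add (by positivity) (by positivity),
          ← ENNReal.ofReal_mul (by positivity)]
        congr 1
        have h1 : a ^ (-p) = |t| ^ p := by
          rw [ha, one_div, Real.inv_rpow ht0.le, Real.rpow_neg ht0.le, inv_inv]
        have h2 : t ^ 2 * a ^ (2 - p) = |t| ^ p := by
          rw [sub_eq_add_neg, Real.rpow_add ha0, h1, ← sq_abs, ha]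
          have := abs_pos.1 ht0
          norm_num
          field_simp
        rw [mul_div_assoc', h2, h1]
        field_simp

/-- Tonelli's theorem for `cosKernel`. -/
theorem lintegral_cosKernel (ν : Measure ℝ) [SFinite ν] (p : ℝ) :
    ∫⁻ t, cosKernel p t ∂ν = ∫⁻ ξ in Set.Ioo (0 : ℝ) 1,
      (∫⁻ t, ENNReal.ofReal (1 - Real.cos (ξ * t)) ∂ν) * ENNReal.ofReal (ξ ^ (-1 - p)) := by
  unfold cosKernel
  rw [lintegral_lintegral_swap (by
    exact Measurable.aemeasurable (Measurable.ennreal_ofReal (by fun_prop)))]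
  refine lintegral_congr fun ξ => ?_
  rw [← lintegral_mul_const' _ _ ENNReal.ofReal_ne_top]
  refine lintegral_congr fun t => ENNReal.ofReal_mul ?_
  linarith [Real.cos_le_one (ξ * t)]

theorem lintegral_one_sub_cos (P : Measure ℝ) [IsProbabilityMeasure P] (ξ : ℝ) :
    ∫⁻ t, ENNReal.ofReal (1 - Real.cos (ξ * t)) ∂P = ENNReal.ofReal (1 - (charFun P ξ).re) := by
  have hint : Integrable (fun x : ℝ => Complex.exp (ξ * x * Complex.I)) P := by
    refine (integrable_const (1 : ℝ)).mono' (by fun_prop) (.of_forall fun x => ?_)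
    rw [← Complex.ofReal_mul, Complex.norm_exp_ofReal_mul_I]
  have hre (t : ℝ) : Real.cos (ξ * t) = (Complex.exp (ξ * t * Complex.I)).re := by
    rw [← Complex.ofReal_mul, Complex.exp_ofReal_mul_I_re]
  have hcos : Integrable (fun t : ℝ => Real.cos (ξ * t)) P := by
    simp only [hre]
    exact hint.re
  have hsub : Integrable (fun t : ℝ => 1 - Real.cos (ξ * t)) P := (integrable_const 1).sub hcos
  rw [← ofReal_integral_eq_lintegral_ofReal hsub
    (.of_forall fun t => by simpa using Real.cos_le_one (ξ * t)),
    integral_sub (integrable_const 1) hcos, charFun_apply_real]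
  simp only [hre, integral_const, probReal_univ, one_smul]
  rw [← Complex.reCLM_apply (∫ x : ℝ, Complex.exp (ξ * x * Complex.I) ∂P),
    ← Complex.reCLM.integral_comp_comm hint]
  rfl

/-- A probability law has a finite moment of order `p` as soon as `1 - Re φ` is integrable against
`ξ^(-1-p)` at the origin, where `φ` is its characteristic function. -/
theorem lintegral_rpow_lt_top_of_charFun {P : Measure ℝ} [IsProbabilityMeasure P] {p : ℝ}
    (hp : 0 < p)
    (h : ∫⁻ ξ in Set.Ioo (0 : ℝ) 1,
      ENNReal.ofReal (1 - (charFun P ξ).re) * ENNReal.ofReal (ξ ^ (-1 - p)) < ∞) :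
    ∫⁻ t, ENNReal.ofReal (|t| ^ p) ∂P < ∞ := by
  have hle (t : ℝ) : ENNReal.ofReal (|t| ^ p) ≤
      1 + ENNReal.ofReal (4 * Real.pi ^ 2) * cosKernel p t := by
    rcases le_total 1 |t| with ht | ht
    · exact (le_cosKernel hp ht).trans le_add_self
    · refine le_trans ?_ le_self_add
      rw [← ENNReal.ofReal_one]
      exact ENNReal.ofReal_le_ofReal (Real.rpow_le_one (abs_nonneg t) ht hp.le)
  refine (lintegral_mono hle).trans_lt ?_
  rw [lintegral_add_left measurable_const, lintegral_const_mul' _ _ ENNReal.ofReal_ne_top,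
    lintegral_cosKernel]
  simp only [lintegral_one_sub_cos]
  exact ENNReal.add_lt_top.2 ⟨by simp, ENNReal.mul_lt_top ENNReal.ofReal_lt_top h⟩

/-- The endpoint `p = 2`: the second moment is finite if `1 - Re φ(ξ) = O(ξ²)`, by Fatou's lemma
applied to the functions `n² (1 - cos (t / n))`. -/
theorem lintegral_sq_lt_top_of_charFun {P : Measure ℝ} [IsProbabilityMeasure P] {C : ℝ}
    (h : ∀ ξ ∈ Set.Ioo (0 : ℝ) 1, 1 - (charFun P ξ).re ≤ C * ξ ^ 2) :
    ∫⁻ t, ENNReal.ofReal (|t| ^ (2 : ℝ)) ∂P < ∞ := by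
  set F : ℕ → ℝ → ℝ≥0∞ := fun n t =>
    ENNReal.ofReal (Real.pi ^ 2 / 2 * (n : ℝ) ^ 2) *
      ENNReal.ofReal (1 - Real.cos ((1 / (n : ℝ)) * t)) with hF
  have hpt (t : ℝ) : ENNReal.ofReal (|t| ^ (2 : ℝ)) ≤ liminf (fun n => F n t) atTop := by
    refine le_liminf_of_le (by isBoundedDefault) ?_
    filter_upwards [eventually_ge_atTop (⌈|t|⌉₊ + 1)] with n hn
    have hn0 : (0 : ℝ) < n := by exact_mod_cast (by omega : 0 < n)
    have htn : |t| ≤ n := (Nat.le_ceil _).trans (by exact_mod_cast (by omega : ⌈|t|⌉₊ ≤ n))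
    simp only [hF]
    rw [← ENNReal.ofReal_mul (by positivity)]
    refine ENNReal.ofReal_le_ofReal ?_
    have hx : |1 / (n : ℝ) * t| ≤ Real.pi := by
      rw [abs_mul, abs_of_pos (by positivity : 0 < 1 / (n : ℝ)), one_div_mul_eq_div]
      exact ((div_le_one hn0).2 htn).trans (by linarith [Real.pi_gt_three])
    have h1 := Real.cos_le_one_sub_mul_cos_sq hx
    have h2 : |t| ^ (2 : ℝ) = Real.pi ^ 2 / 2 * (n : ℝ) ^ 2 *
        (2 / Real.pi ^ 2 * (1 / (n : ℝ) * t) ^ 2) := by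
      have := Real.pi_pos
      rw [Real.rpow_two, sq_abs]
      field_simp
    rw [h2]
    gcongr
    linarith
  refine ((lintegral_mono hpt).trans (lintegral_liminf_le fun n => by fun_prop)).trans_lt ?_
  refine lt_of_le_of_lt (b := ENNReal.ofReal (Real.pi ^ 2 / 2 * C)) ?_ ENNReal.ofReal_lt_top
  refine liminf_le_of_frequently_le' (Eventually.frequently ?_)
  filter_upwards [eventually_ge_atTop 2] with n hn
  have hn' : (2 : ℝ) ≤ n := by exact_mod_cast hn
  have hn0 : (0 : ℝ) < n := by linarith
  rw [lintegral_const_mul' _ _ ENNReal.ofReal_ne_top, lintegral_one_sub_cos,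
    ← ENNReal.ofReal_mul (by positivity)]
  refine ENNReal.ofReal_le_ofReal ?_
  have h1 := h (1 / n) ⟨by positivity, (div_lt_one hn0).2 (by linarith)⟩
  calc Real.pi ^ 2 / 2 * (n : ℝ) ^ 2 * (1 - (charFun P (1 / n)).re)
      ≤ Real.pi ^ 2 / 2 * (n : ℝ) ^ 2 * (C * (1 / n) ^ 2) := by gcongr
    _ = Real.pi ^ 2 / 2 * C := by field_simp

/-! ### A Lévy exponent at the origin -/

theorem measurable_indicator_abs_le_one :
    Measurable ({u : ℝ | |u| ≤ 1}.indicator (fun u => u)) :=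
  measurable_id.indicator (measurableSet_le (by fun_prop) measurable_const)

theorem indicator_abs_le_one_neg (t : ℝ) : {u : ℝ | |u| ≤ 1}.indicator (fun u => u) (-t) =
    -{u : ℝ | |u| ≤ 1}.indicator (fun u => u) t := by
  by_cases ht : |t| ≤ 1
  · rw [Set.indicator_of_mem (by simpa using ht), Set.indicator_of_mem (by simpa using ht)]
  · rw [Set.indicator_of_notMem (by simpa using ht), Set.indicator_of_notMem (by simpa using ht),
      neg_zero]

/-- The integrand of the Lévy–Khintchine formula. -/
noncomputable def levyIntegrand (ξ t : ℝ) : ℂ :=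
  Complex.exp (Complex.I * ξ * t) - 1
    - Complex.I * ξ * ({u : ℝ | |u| ≤ 1}.indicator (fun u => u) t : ℝ)

theorem measurable_levyIntegrand (ξ : ℝ) : Measurable (levyIntegrand ξ) := by
  have h := measurable_indicator_abs_le_one
  unfold levyIntegrand
  fun_prop

theorem levyIntegrand_re (ξ t : ℝ) : (levyIntegrand ξ t).re = Real.cos (ξ * t) - 1 := by
  have h : Complex.I * ξ * t = ((ξ * t : ℝ) : ℂ) * Complex.I := by push_cast; ring
  rw [levyIntegrand, h, Complex.sub_re, Complex.sub_re, Complex.exp_ofReal_mul_I_re]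
  simp

theorem levyIntegrand_im (ξ t : ℝ) : (levyIntegrand ξ t).im =
    Real.sin (ξ * t) - ξ * {u : ℝ | |u| ≤ 1}.indicator (fun u => u) t := by
  have h : Complex.I * ξ * t = ((ξ * t : ℝ) : ℂ) * Complex.I := by push_cast; ring
  rw [levyIntegrand, h, Complex.sub_im, Complex.sub_im, Complex.exp_ofReal_mul_I_im]
  simp

theorem levyIntegrand_neg (ξ t : ℝ) :
    levyIntegrand ξ (-t) = (starRingEnd ℂ) (levyIntegrand ξ t) := by
  apply Complex.ext
  · simp [levyIntegrand_re]
  · rw [Complex.conj_im, levyIntegrand_im, levyIntegrand_im, indicator_abs_le_one_neg, mul_neg,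
      Real.sin_neg]
    ring

theorem norm_levyIntegrand_le_of_abs_le {ξ t : ℝ} (hξ : |ξ| ≤ 1) (ht : |t| ≤ 1) :
    ‖levyIntegrand ξ t‖ ≤ ξ ^ 2 * t ^ 2 := by
  have hnorm : ‖Complex.I * ξ * t‖ = |ξ| * |t| := by simp
  rw [levyIntegrand, Set.indicator_of_mem (by simpa using ht)]
  refine (Complex.norm_exp_sub_one_sub_id_le ?_).trans_eq ?_
  · rw [hnorm]
    exact mul_le_one₀ hξ (abs_nonneg t) ht
  · rw [hnorm, mul_pow, sq_abs, sq_abs]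

theorem norm_levyIntegrand_le {ξ t : ℝ} (hξ : |ξ| ≤ 1) :
    ‖levyIntegrand ξ t‖ ≤ 2 * min 1 (t ^ 2) := by
  by_cases ht : |t| ≤ 1
  · have h1 : t ^ 2 ≤ 1 := (sq_le_one_iff_abs_le_one t).2 ht
    have h2 : ξ ^ 2 ≤ 1 := (sq_le_one_iff_abs_le_one ξ).2 hξ
    rw [min_eq_right h1]
    nlinarith [norm_levyIntegrand_le_of_abs_le hξ ht, sq_nonneg t]
  · have h1 : 1 ≤ t ^ 2 := (one_le_sq_iff_one_le_abs t).2 (not_le.1 ht).le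
    have h : Complex.I * ξ * t = Complex.I * ((ξ * t : ℝ) : ℂ) := by push_cast; ring
    rw [min_eq_left h1, levyIntegrand, Set.indicator_of_notMem (by simpa using ht), h]
    simp only [Complex.ofReal_zero, mul_zero, sub_zero]
    refine (norm_sub_le _ _).trans ?_
    rw [Complex.norm_exp_I_mul_ofReal, norm_one]
    norm_num

theorem IsLevyMeasure.integrable_min {V : Measure ℝ} (hV : IsLevyMeasure V) :
    Integrable (fun t : ℝ => min 1 (t ^ 2)) V :=
  ⟨by fun_prop, by
    rw [hasFiniteIntegral_iff_ofReal (.of_forall fun t => by positivity)]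
    exact hV.1⟩

theorem IsLevyMeasure.integrable_levyIntegrand {V : Measure ℝ} (hV : IsLevyMeasure V) {ξ : ℝ}
    (hξ : |ξ| ≤ 1) : Integrable (levyIntegrand ξ) V :=
  (hV.integrable_min.const_mul 2).mono' (measurable_levyIntegrand ξ).aestronglyMeasurable
    (.of_forall fun _ => norm_levyIntegrand_le hξ)

theorem measurableSet_one_le_abs : MeasurableSet {t : ℝ | 1 ≤ |t|} :=
  measurableSet_le measurable_const (by fun_prop)

theorem IsLevyMeasure.lintegral_sq_lt_top {V : Measure ℝ} (hV : IsLevyMeasure V) :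
    ∫⁻ t in {t : ℝ | 1 ≤ |t|}ᶜ, ENNReal.ofReal (t ^ 2) ∂V < ∞ := by
  refine lt_of_le_of_lt ?_ hV.1
  refine (setLIntegral_mono' measurableSet_one_le_abs.compl fun t ht => ?_).trans
    (setLIntegral_le_lintegral _ _)
  have ht' : |t| ≤ 1 := le_of_lt (by simpa using ht)
  rw [min_eq_right ((sq_le_one_iff_abs_le_one t).2 ht')]

theorem IsLevyMeasure.isFiniteMeasure_restrict {V : Measure ℝ} (hV : IsLevyMeasure V) :
    IsFiniteMeasure (V.restrict {t : ℝ | 1 ≤ |t|}) := by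
  refine ⟨lt_of_le_of_lt ?_ hV.1⟩
  rw [Measure.restrict_apply_univ, ← setLIntegral_one]
  refine (setLIntegral_mono' measurableSet_one_le_abs fun t ht => ?_).trans
    (setLIntegral_le_lintegral _ _)
  rw [min_eq_left ((one_le_sq_iff_one_le_abs t).2 ht), ENNReal.ofReal_one]

theorem FiniteTailMoment.mono {V : Measure ℝ} {p q : ℝ} (h : FiniteTailMoment q V) (hpq : p ≤ q) :
    FiniteTailMoment p V := by
  refine lt_of_le_of_lt (setLIntegral_mono' measurableSet_one_le_abs fun t ht => ?_) h
  exact ENNReal.ofReal_le_ofReal (Real.rpow_le_rpow_of_exponent_le ht hpq)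

open Classical in
/-- The function equal to `t²` for `|t| < 1` and to `|t|ᵖ` for `|t| ≥ 1`. -/
noncomputable def truncatedPower (p t : ℝ) : ℝ :=
  if 1 ≤ |t| then |t| ^ p else t ^ 2

theorem integrable_truncatedPower {V : Measure ℝ} (hV : IsLevyMeasure V) {p : ℝ}
    (hp : FiniteTailMoment p V) : Integrable (truncatedPower p) V := by
  have hnn (t : ℝ) : 0 ≤ truncatedPower p t := by
    unfold truncatedPower
    split_ifs <;> positivity
  have hmeas : Measurable (truncatedPower p) :=
    Measurable.ite measurableSet_one_le_abs (by fun_prop) (by fun_prop)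
  refine ⟨hmeas.aestronglyMeasurable, ?_⟩
  rw [hasFiniteIntegral_iff_ofReal (.of_forall hnn),
    ← lintegral_add_compl _ measurableSet_one_le_abs]
  refine ENNReal.add_lt_top.2 ⟨?_, ?_⟩
  · refine (setLIntegral_congr_fun measurableSet_one_le_abs fun t ht => ?_).trans_lt hp
    rw [Set.mem_ofPred_eq] at ht
    simp only [truncatedPower, if_pos ht]
  · refine (setLIntegral_congr_fun measurableSet_one_le_abs.compl fun t ht => ?_).trans_lt
      hV.lintegral_sq_lt_top
    rw [Set.mem_compl_iff, Set.mem_ofPred_eq] at ht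
    simp only [truncatedPower, if_neg ht]

theorem abs_sin_le_rpow {p : ℝ} (hp : 0 ≤ p) (hp1 : p ≤ 1) (x : ℝ) : |Real.sin x| ≤ |x| ^ p := by
  rcases le_total |x| 1 with hx | hx
  · rcases (abs_nonneg x).eq_or_lt with h0 | h0
    · rw [abs_eq_zero.1 h0.symm]
      simpa using Real.rpow_nonneg le_rfl p
    · exact Real.abs_sin_le_abs.trans (Real.self_le_rpow_of_le_one h0.le hx hp1)
  · exact (Real.abs_sin_le_one x).trans (Real.one_le_rpow hx hp)

section Triplet

variable {m s : ℝ} {V : Measure ℝ} {f : ℝ → ℂ}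

theorem IsLevyTriplet.eq_integral (h : IsLevyTriplet m s V f) (ξ : ℝ) :
    f ξ = Complex.I * m * ξ - s * ξ ^ 2 / 2 + ∫ t, levyIntegrand ξ t ∂V :=
  h.2.2 ξ

theorem IsLevyTriplet.re_eq (h : IsLevyTriplet m s V f) {ξ : ℝ} (hξ : |ξ| ≤ 1) :
    -(f ξ).re = s * ξ ^ 2 / 2 + ∫ t, (1 - Real.cos (ξ * t)) ∂V := by
  have h1 : (∫ t, levyIntegrand ξ t ∂V).re = ∫ t, (levyIntegrand ξ t).re ∂V :=
    (Complex.reCLM.integral_comp_comm (h.2.1.integrable_levyIntegrand hξ)).symm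
  have h2 : ∫ t, (levyIntegrand ξ t).re ∂V = -∫ t, (1 - Real.cos (ξ * t)) ∂V := by
    rw [← integral_neg]
    simp [levyIntegrand_re]
  have h3 : (Complex.I * m * ξ - s * ξ ^ 2 / 2 : ℂ).re = -(s * ξ ^ 2 / 2) := by
    have : (s * ξ ^ 2 / 2 : ℂ) = ((s * ξ ^ 2 / 2 : ℝ) : ℂ) := by push_cast; ring
    rw [Complex.sub_re, this, Complex.ofReal_re]
    simp
  rw [h.eq_integral, Complex.add_re, h1, h2, h3]
  ring

theorem IsLevyTriplet.integrable_one_sub_cos (h : IsLevyTriplet m s V f) {ξ : ℝ} (hξ : |ξ| ≤ 1) :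
    Integrable (fun t => 1 - Real.cos (ξ * t)) V := by
  refine (h.2.1.integrable_levyIntegrand hξ).re.neg.congr (.of_forall fun t => ?_)
  simp [levyIntegrand_re]

theorem IsLevyTriplet.re_nonpos (h : IsLevyTriplet m s V f) {ξ : ℝ} (hξ : |ξ| ≤ 1) :
    (f ξ).re ≤ 0 := by
  have h1 := h.re_eq hξ
  have h2 : 0 ≤ ∫ t, (1 - Real.cos (ξ * t)) ∂V :=
    integral_nonneg fun t => by simpa using Real.cos_le_one (ξ * t)
  nlinarith [h.1, sq_nonneg ξ]

/-- A symmetric triplet without drift has a real exponent. -/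
theorem IsLevyTriplet.im_eq_zero (h : IsLevyTriplet m s V f) (hV : IsSymmetricMeasure V)
    (hm : m = 0) (ξ : ℝ) : (f ξ).im = 0 := by
  have h1 : (starRingEnd ℂ) (∫ t, levyIntegrand ξ t ∂V) = ∫ t, levyIntegrand ξ t ∂V := by
    rw [← integral_conj]
    conv_rhs => rw [← hV, integral_map measurable_neg.aemeasurable
      (measurable_levyIntegrand ξ).aestronglyMeasurable]
    simp only [levyIntegrand_neg]
  have h2 : (s * ξ ^ 2 / 2 : ℂ) = ((s * ξ ^ 2 / 2 : ℝ) : ℂ) := by push_cast; ring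
  rw [h.eq_integral, hm, h2, Complex.add_im, Complex.conj_eq_iff_im.1 h1, Complex.sub_im,
    Complex.ofReal_im]
  simp

/-- `Im f(ξ) = O(|ξ|ᵖ)` at the origin if the Lévy measure has a tail moment of order `p ≤ 1`. -/
theorem IsLevyTriplet.exists_abs_im_le (h : IsLevyTriplet m s V f) {p : ℝ} (hp : 0 < p)
    (hp1 : p ≤ 1) (hmom : FiniteTailMoment p V) :
    ∃ C : ℝ, ∀ ξ ∈ Set.Ioo (0 : ℝ) 1, |(f ξ).im| ≤ C * ξ ^ p := by
  refine ⟨|m| + ∫ t, truncatedPower p t ∂V, fun ξ hξ => ?_⟩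
  have hξ1 : |ξ| ≤ 1 := by rw [abs_of_pos hξ.1]; exact hξ.2.le
  have hξp : ξ ≤ ξ ^ p := Real.self_le_rpow_of_le_one hξ.1.le hξ.2.le hp1
  have hξp0 : 0 ≤ ξ ^ p := Real.rpow_nonneg hξ.1.le p
  have hξ2 : ξ ^ 2 ≤ ξ ^ p := by nlinarith [hξ.1, hξ.2]
  have him : (∫ t, levyIntegrand ξ t ∂V).im = ∫ t, (levyIntegrand ξ t).im ∂V :=
    (Complex.imCLM.integral_comp_comm (h.2.1.integrable_levyIntegrand hξ1)).symm
  have hbound (t : ℝ) : ‖(levyIntegrand ξ t).im‖ ≤ ξ ^ p * truncatedPower p t := by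
    by_cases ht : |t| ≤ 1
    · have h1 := (Complex.abs_im_le_norm _).trans (norm_levyIntegrand_le_of_abs_le hξ1 ht)
      have h2 : t ^ 2 ≤ truncatedPower p t := by
        unfold truncatedPower
        split_ifs with h3
        · rw [← sq_abs, le_antisymm ht h3]
          simp
        · exact le_rfl
      exact h1.trans (mul_le_mul hξ2 h2 (sq_nonneg t) hξp0)
    · have ht' : 1 ≤ |t| := (not_le.1 ht).le
      rw [levyIntegrand_im, Set.indicator_of_notMem (by simpa using ht), mul_zero, sub_zero,
        truncatedPower, if_pos ht', ← Real.mul_rpow hξ.1.le (abs_nonneg t)]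
      refine (abs_sin_le_rpow hp.le hp1 (ξ * t)).trans_eq ?_
      rw [abs_mul, abs_of_pos hξ.1]
  have hint := norm_integral_le_of_norm_le
    ((integrable_truncatedPower h.2.1 hmom).const_mul (ξ ^ p)) (.of_forall hbound)
  rw [integral_const_mul, Real.norm_eq_abs, ← him] at hint
  have h2 : (s * ξ ^ 2 / 2 : ℂ) = ((s * ξ ^ 2 / 2 : ℝ) : ℂ) := by push_cast; ring
  have h3 : (f ξ).im = m * ξ + (∫ t, levyIntegrand ξ t ∂V).im := by
    rw [h.eq_integral, h2, Complex.add_im, Complex.sub_im, Complex.ofReal_im]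
    simp
  calc |(f ξ).im| ≤ |m * ξ| + |(∫ t, levyIntegrand ξ t ∂V).im| := by rw [h3]; exact abs_add_le _ _
    _ ≤ |m| * ξ ^ p + ξ ^ p * ∫ t, truncatedPower p t ∂V := by
        rw [abs_mul, abs_of_pos hξ.1]
        gcongr
    _ = _ := by ring

/-- `Re f(ξ) = O(ξ²)` at the origin if the Lévy measure has a second tail moment. -/
theorem IsLevyTriplet.exists_neg_re_le (h : IsLevyTriplet m s V f)
    (hmom : FiniteTailMoment 2 V) :
    ∃ C : ℝ, ∀ ξ ∈ Set.Ioo (0 : ℝ) 1, -(f ξ).re ≤ C * ξ ^ 2 := by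
  refine ⟨s / 2 + ∫ t, truncatedPower 2 t ∂V, fun ξ hξ => ?_⟩
  have hξ1 : |ξ| ≤ 1 := by rw [abs_of_pos hξ.1]; exact hξ.2.le
  have hint := integrable_truncatedPower h.2.1 hmom
  have hle : ∫ t, (1 - Real.cos (ξ * t)) ∂V ≤ ∫ t, ξ ^ 2 * truncatedPower 2 t ∂V := by
    refine integral_mono (h.integrable_one_sub_cos hξ1) (hint.const_mul _) fun t => ?_
    have h1 : truncatedPower 2 t = t ^ 2 := by simp [truncatedPower]
    have h2 := Real.one_sub_sq_div_two_le_cos (x := ξ * t)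
    simp only [h1]
    nlinarith [sq_nonneg (ξ * t)]
  rw [integral_const_mul] at hle
  rw [h.re_eq hξ1]
  linarith

/-- Up to `O(ξ²)`, the real part of a Lévy exponent at the origin comes from the tail of the Lévy
measure. -/
theorem IsLevyTriplet.exists_ofReal_neg_re_le (h : IsLevyTriplet m s V f) :
    ∃ C : ℝ, ∀ ξ ∈ Set.Ioo (0 : ℝ) 1, ENNReal.ofReal (-(f ξ).re) ≤ ENNReal.ofReal (C * ξ ^ 2) +
      ∫⁻ t in {t : ℝ | 1 ≤ |t|}, ENNReal.ofReal (1 - Real.cos (ξ * t)) ∂V := by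
  set K := ∫⁻ t in {t : ℝ | 1 ≤ |t|}ᶜ, ENNReal.ofReal (t ^ 2) ∂V with hK
  have hKtop : K ≠ ∞ := h.2.1.lintegral_sq_lt_top.ne
  refine ⟨s / 2 + K.toReal, fun ξ hξ => ?_⟩
  have hξ1 : |ξ| ≤ 1 := by rw [abs_of_pos hξ.1]; exact hξ.2.le
  have hs : 0 ≤ s := h.1
  have hsmall : ∫⁻ t in {t : ℝ | 1 ≤ |t|}ᶜ, ENNReal.ofReal (1 - Real.cos (ξ * t)) ∂V ≤
      ENNReal.ofReal (K.toReal * ξ ^ 2) := by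
    rw [mul_comm, ENNReal.ofReal_mul (sq_nonneg ξ), ENNReal.ofReal_toReal hKtop, hK,
      ← lintegral_const_mul' _ _ ENNReal.ofReal_ne_top]
    refine lintegral_mono fun t => ?_
    rw [← ENNReal.ofReal_mul (sq_nonneg ξ)]
    refine ENNReal.ofReal_le_ofReal ?_
    nlinarith [Real.one_sub_sq_div_two_le_cos (x := ξ * t), sq_nonneg (ξ * t)]
  have hnn : 0 ≤ ∫ t, (1 - Real.cos (ξ * t)) ∂V :=
    integral_nonneg fun t => by simpa using Real.cos_le_one (ξ * t)
  rw [h.re_eq hξ1, ENNReal.ofReal_add (by positivity) hnn,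
    ofReal_integral_eq_lintegral_ofReal (h.integrable_one_sub_cos hξ1)
      (.of_forall fun t => by simpa using Real.cos_le_one (ξ * t)),
    ← lintegral_add_compl _ measurableSet_one_le_abs, add_mul,
    ENNReal.ofReal_add (by positivity) (by positivity), add_assoc]
  refine add_le_add (le_of_eq (by ring_nf)) ?_
  rw [add_comm]
  exact add_le_add_left hsmall _

/-! ### Moments of infinitely divisible laws -/

theorem one_sub_exp_re_le {z : ℂ} (hz : z.re ≤ 0) :
    1 - (Complex.exp z).re ≤ -z.re + z.im ^ 2 / 2 := by
  rw [Complex.exp_re]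
  have h1 := Real.add_one_le_exp z.re
  have h2 : Real.exp z.re ≤ 1 := Real.exp_le_one_iff.2 hz
  have h3 := Real.one_sub_sq_div_two_le_cos (x := z.im)
  have h4 := Real.exp_pos z.re
  nlinarith [sq_nonneg z.im]

/-- A tail moment of order `p` of the Lévy measure gives a moment of order `p` of the infinitely
divisible law, for `p ≤ 1` in general and for `p ≤ 2` if the exponent is real. -/
theorem IsLevyTriplet.lintegral_rpow_lt_top (h : IsLevyTriplet m s V f) {p : ℝ} (hp : 0 < p)
    (hp2 : p ≤ 2) (hmom : FiniteTailMoment p V) (hsymm : p ≤ 1 ∨ ∀ ξ, (f ξ).im = 0)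
    {τ : ℝ} (hτ : 0 ≤ τ) {P : Measure ℝ} [IsProbabilityMeasure P]
    (hP : ∀ ξ, charFun P ξ = Complex.exp (τ * f ξ)) :
    ∫⁻ t, ENNReal.ofReal (|t| ^ p) ∂P < ∞ := by
  have hle {ξ : ℝ} (hξ : ξ ∈ Set.Ioo (0 : ℝ) 1) :
      1 - (charFun P ξ).re ≤ τ * -(f ξ).re + τ ^ 2 * (f ξ).im ^ 2 / 2 := by
    have hξ1 : |ξ| ≤ 1 := by rw [abs_of_pos hξ.1]; exact hξ.2.le
    have hre : (τ * f ξ : ℂ).re = τ * (f ξ).re := Complex.re_ofReal_mul _ _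
    have him : (τ * f ξ : ℂ).im = τ * (f ξ).im := Complex.im_ofReal_mul _ _
    have := one_sub_exp_re_le (z := τ * f ξ)
      (hre ▸ mul_nonpos_of_nonneg_of_nonpos hτ (h.re_nonpos hξ1))
    rw [hre, him, ← hP, mul_pow] at this
    linarith
  rcases hp2.eq_or_lt with rfl | hp2
  · obtain ⟨C, hC⟩ := h.exists_neg_re_le hmom
    refine lintegral_sq_lt_top_of_charFun (C := τ * C) fun ξ hξ => (hle hξ).trans ?_
    rw [(hsymm.resolve_left (by norm_num)) ξ]
    nlinarith [mul_le_mul_of_nonneg_left (hC ξ hξ) hτ]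
  -- in both cases `(Im f)²` is integrable against `ξ^(-1-p)`
  obtain ⟨D, hD⟩ : ∃ D : ℝ, ∀ ξ ∈ Set.Ioo (0 : ℝ) 1, (f ξ).im ^ 2 ≤ D * ξ ^ (2 * p) := by
    rcases hsymm with hp1 | hsymm
    · obtain ⟨C, hC⟩ := h.exists_abs_im_le hp hp1 hmom
      refine ⟨C ^ 2, fun ξ hξ => ?_⟩
      rw [two_mul, Real.rpow_add hξ.1, ← sq, ← mul_pow, ← sq_abs]
      exact pow_le_pow_left₀ (abs_nonneg _) (hC ξ hξ) 2
    · exact ⟨0, fun ξ _ => by rw [hsymm ξ]; simp⟩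
  obtain ⟨C, hC⟩ := h.exists_ofReal_neg_re_le
  have hfin := h.2.1.isFiniteMeasure_restrict
  refine lintegral_rpow_lt_top_of_charFun hp ?_
  set T : ℝ → ℝ≥0∞ := fun ξ =>
    (∫⁻ t in {t : ℝ | 1 ≤ |t|}, ENNReal.ofReal (1 - Real.cos (ξ * t)) ∂V) *
      ENNReal.ofReal (ξ ^ (-1 - p)) with hT
  have hTfin : ∫⁻ ξ in Set.Ioo (0 : ℝ) 1, T ξ < ∞ := by
    rw [← lintegral_cosKernel]
    refine (setLIntegral_mono' measurableSet_one_le_abs fun t ht =>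
      cosKernel_le hp hp2 ht).trans_lt ?_
    rw [lintegral_const_mul' _ _ ENNReal.ofReal_ne_top]
    exact ENNReal.mul_lt_top ENNReal.ofReal_lt_top hmom
  have hpow {a : ℝ} (ha : -1 < a) (c : ℝ) :
      ∫⁻ ξ in Set.Ioo (0 : ℝ) 1, ENNReal.ofReal (c * ξ ^ a) < ∞ := by
    have := ((intervalIntegral.integrableOn_Ioo_rpow_iff one_pos).2 ha).const_mul c
    exact this.lintegral_lt_top
  have hmeas (c a : ℝ) : Measurable fun ξ : ℝ => ENNReal.ofReal (c * ξ ^ a) := by fun_prop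
  calc ∫⁻ ξ in Set.Ioo (0 : ℝ) 1,
        ENNReal.ofReal (1 - (charFun P ξ).re) * ENNReal.ofReal (ξ ^ (-1 - p))
      ≤ ∫⁻ ξ in Set.Ioo (0 : ℝ) 1, (ENNReal.ofReal (τ ^ 2 * D / 2 * ξ ^ (p - 1)) +
          ENNReal.ofReal τ * (ENNReal.ofReal (C * ξ ^ (1 - p)) + T ξ)) := by
        refine setLIntegral_mono' measurableSet_Ioo fun ξ hξ => ?_
        have e1 : ENNReal.ofReal (C * ξ ^ (1 - p)) =
            ENNReal.ofReal (C * ξ ^ 2) * ENNReal.ofReal (ξ ^ (-1 - p)) := by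
          rw [← ENNReal.ofReal_mul' (Real.rpow_nonneg hξ.1.le _), mul_assoc,
            ← Real.rpow_natCast ξ 2, ← Real.rpow_add hξ.1]
          norm_num
          ring_nf
        have e2 : ENNReal.ofReal (τ ^ 2 * D / 2 * ξ ^ (p - 1)) =
            ENNReal.ofReal (τ ^ 2 * D / 2 * ξ ^ (2 * p)) * ENNReal.ofReal (ξ ^ (-1 - p)) := by
          rw [← ENNReal.ofReal_mul' (Real.rpow_nonneg hξ.1.le _), mul_assoc, ← Real.rpow_add hξ.1]
          ring_nf
        rw [e1, e2, hT]
        simp only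
        rw [← add_mul, ← mul_assoc, ← add_mul]
        refine mul_le_mul_left ?_ _
        calc ENNReal.ofReal (1 - (charFun P ξ).re)
            ≤ ENNReal.ofReal (τ * -(f ξ).re + τ ^ 2 * D / 2 * ξ ^ (2 * p)) := by
              refine ENNReal.ofReal_le_ofReal ((hle hξ).trans ?_)
              nlinarith [mul_le_mul_of_nonneg_left (hD ξ hξ) (sq_nonneg τ)]
          _ ≤ ENNReal.ofReal (τ ^ 2 * D / 2 * ξ ^ (2 * p)) +
                ENNReal.ofReal τ * ENNReal.ofReal (-(f ξ).re) := by
              rw [← ENNReal.ofReal_mul hτ, add_comm]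
              exact ENNReal.ofReal_add_le
          _ ≤ _ := by gcongr; exact hC ξ hξ
    _ < ∞ := by
        rw [lintegral_add_left (hmeas _ _), lintegral_const_mul' _ _ ENNReal.ofReal_ne_top,
          lintegral_add_left (hmeas _ _)]
        exact ENNReal.add_lt_top.2 ⟨hpow (by linarith) _, ENNReal.mul_lt_top ENNReal.ofReal_lt_top
          (ENNReal.add_lt_top.2 ⟨hpow (by linarith) _, hTfin⟩)⟩

end Triplet

/-! ### Exponents of impulsive noises -/

/-- The drift of the exponent `r (Ĵ - 1)`. -/
noncomputable def impulsiveDrift (r : ℝ) (J : Measure ℝ) : ℝ :=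
  r * ∫ t, {u : ℝ | |u| ≤ 1}.indicator (fun u => u) t ∂J

/-- The Lévy measure of the exponent `r (Ĵ - 1)`: the atom of `J` at `0` is removed. -/
noncomputable def impulsiveLevyMeasure (r : ℝ) (J : Measure ℝ) : Measure ℝ :=
  ENNReal.ofReal r • J.restrict {0}ᶜ

section JumpLaw

variable {r : ℝ} {J : Measure ℝ}

theorem lintegral_impulsiveLevyMeasure_le (g : ℝ → ℝ≥0∞) :
    ∫⁻ t, g t ∂impulsiveLevyMeasure r J ≤ ENNReal.ofReal r * ∫⁻ t, g t ∂J := by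
  rw [impulsiveLevyMeasure, lintegral_smul_measure, smul_eq_mul]
  gcongr
  exact Measure.restrict_le_self

theorem isLevyTriplet_impulsiveExponent (hr : 0 ≤ r) [IsProbabilityMeasure J] :
    IsLevyTriplet (impulsiveDrift r J) 0 (impulsiveLevyMeasure r J) (impulsiveExponent r J) := by
  refine ⟨le_rfl, ⟨?_, ?_⟩, fun ξ => ?_⟩
  · refine (lintegral_impulsiveLevyMeasure_le _).trans_lt
      (ENNReal.mul_lt_top ENNReal.ofReal_lt_top ?_)
    refine (lintegral_mono fun t => ENNReal.ofReal_le_ofReal (min_le_left 1 (t ^ 2))).trans_lt ?_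
    simp
  · simp [impulsiveLevyMeasure]
  · set ind : ℝ → ℝ := {u : ℝ | |u| ≤ 1}.indicator (fun u => u) with hind
    have hind_int : Integrable ind J := by
      refine (integrable_const (1 : ℝ)).mono' measurable_indicator_abs_le_one.aestronglyMeasurable
        (.of_forall fun t => ?_)
      by_cases ht : |t| ≤ 1
      · rwa [hind, Set.indicator_of_mem (by simpa using ht)]
      · rw [hind, Set.indicator_of_notMem (by simpa using ht)]
        simp
    have hexp_int : Integrable (fun t : ℝ => Complex.exp (Complex.I * ξ * t)) J := by
      refine (integrable_const (1 : ℝ)).mono' (by fun_prop) (.of_forall fun t => ?_)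
      rw [mul_assoc, ← Complex.ofReal_mul, Complex.norm_exp_I_mul_ofReal]
    have hexp_sub_int : Integrable (fun t : ℝ => Complex.exp (Complex.I * ξ * t) - 1) J :=
      hexp_int.sub (integrable_const 1)
    have hmul_int : Integrable (fun t : ℝ => Complex.I * ξ * (ind t : ℂ)) J :=
      hind_int.ofReal.const_mul _
    have hzero : ∫ t in {(0 : ℝ)}ᶜ, levyIntegrand ξ t ∂J = ∫ t, levyIntegrand ξ t ∂J := by
      refine setIntegral_eq_integral_of_forall_compl_eq_zero fun t ht => ?_
      have : t = 0 := by simpa using ht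
      simp [this, levyIntegrand]
    have hval : ∫ t, levyIntegrand ξ t ∂J =
        charFun J ξ - 1 - Complex.I * ξ * ((∫ t, ind t ∂J : ℝ) : ℂ) := by
      unfold levyIntegrand
      rw [integral_sub hexp_sub_int hmul_int, integral_sub hexp_int (integrable_const 1), integral_const_mul, integral_complex_ofReal,
        charFun_apply_real]
      simp only [integral_const, probReal_univ, one_smul]
      congr 3
      funext t
      ring_nf
    change impulsiveExponent r J ξ = _ + ∫ t, levyIntegrand ξ t ∂impulsiveLevyMeasure r J
    rw [impulsiveLevyMeasure, integral_smul_measure, hzero, hval, ENNReal.toReal_ofReal hr,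
      Complex.real_smul, impulsiveDrift, impulsiveExponent]
    push_cast
    ring

theorem isLevyExponent_impulsiveExponent (hr : 0 ≤ r) [IsProbabilityMeasure J] :
    IsLevyExponent (impulsiveExponent r J) := by
  refine ⟨?_, by simp [impulsiveExponent], compoundPoissonLaw r J,
    isInfinitelyDivisible_compoundPoissonLaw hr J, charFun_compoundPoissonLaw hr J⟩
  unfold impulsiveExponent
  fun_prop

theorem finiteTailMoment_impulsiveLevyMeasure {p : ℝ}
    (h : ∫⁻ t, ENNReal.ofReal (|t| ^ p) ∂J < ∞) : FiniteTailMoment p (impulsiveLevyMeasure r J) :=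
  ((setLIntegral_le_lintegral _ _).trans (lintegral_impulsiveLevyMeasure_le _)).trans_lt
    (ENNReal.mul_lt_top ENNReal.ofReal_lt_top h)

theorem finiteLocalMoment_impulsiveLevyMeasure {p : ℝ}
    (h : ∫⁻ t, ENNReal.ofReal (|t| ^ p) ∂J < ∞) : FiniteLocalMoment p (impulsiveLevyMeasure r J) :=
  ((setLIntegral_le_lintegral _ _).trans (lintegral_impulsiveLevyMeasure_le _)).trans_lt
    (ENNReal.mul_lt_top ENNReal.ofReal_lt_top h)

theorem isSymmetricMeasure_of_charFun_im_eq_zero [IsFiniteMeasure J]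
    (h : ∀ ξ, (charFun J ξ).im = 0) : IsSymmetricMeasure J := by
  refine Measure.ext_of_charFun (funext fun ξ => ?_)
  have h1 := charFun_map_mul (μ := J) (-1) ξ
  simp only [neg_one_mul] at h1
  rw [h1, charFun_neg, Complex.conj_eq_iff_im.2 (h ξ)]

theorem IsSymmetricMeasure.impulsiveLevyMeasure (h : IsSymmetricMeasure J) :
    IsSymmetricMeasure (impulsiveLevyMeasure r J) := by
  have hpre : (fun t : ℝ => -t) ⁻¹' {0}ᶜ = {0}ᶜ := by ext t; simp
  have hmap := Measure.restrict_map (μ := J) (f := fun t : ℝ => -t) measurable_neg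
    (s := {0}ᶜ) (measurableSet_singleton 0).compl
  rw [hpre, show J.map (fun t : ℝ => -t) = J from h] at hmap
  rw [IsSymmetricMeasure, LevyCompat.impulsiveLevyMeasure, Measure.map_smul, ← hmap]

theorem IsSymmetricMeasure.impulsiveDrift_eq_zero (h : IsSymmetricMeasure J) :
    impulsiveDrift r J = 0 := by
  have h1 : ∫ t, {u : ℝ | |u| ≤ 1}.indicator (fun u => u) t ∂J =
      -∫ t, {u : ℝ | |u| ≤ 1}.indicator (fun u => u) t ∂J := by
    conv_lhs => rw [← show J.map (fun t : ℝ => -t) = J from h,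
      integral_map (f := {u : ℝ | |u| ≤ 1}.indicator (fun u => u)) (φ := fun t : ℝ => -t)
        measurable_neg.aemeasurable measurable_indicator_abs_le_one.aestronglyMeasurable]
    simp only [indicator_abs_le_one_neg, integral_neg]
  rw [impulsiveDrift, show ∫ t, {u : ℝ | |u| ≤ 1}.indicator (fun u => u) t ∂J = 0 by linarith,
    mul_zero]

/-- The conditions on a law of jumps under which its impulsive exponents inherit compatibility at
the integrability order `p`: a moment of order `p`, and symmetry if `p > 1`. Symmetry is expressed
by the characteristic function being real. -/
structure IsAdmissibleJumpLaw (p : ℝ) (J : Measure ℝ) : Prop where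
  isProbabilityMeasure : IsProbabilityMeasure J
  moment : ∫⁻ t, ENNReal.ofReal (|t| ^ p) ∂J < ∞
  symm : p ≤ 1 ∨ ∀ ξ, (charFun J ξ).im = 0

theorem IsPTriplet.isAdmissibleJumpLaw {pmin pmax m s : ℝ} {V : Measure ℝ} {f : ℝ → ℂ}
    (hpt : IsPTriplet pmin pmax m s V) (hf : IsLevyTriplet m s V f) (hp : 0 < pmin)
    (hp2 : pmin ≤ 2) {τ : ℝ} (hτ : 0 ≤ τ) {Q : Measure ℝ} [hQ : IsProbabilityMeasure Q]
    (hQf : ∀ ξ, charFun Q ξ = Complex.exp (τ * f ξ)) : IsAdmissibleJumpLaw pmin Q := by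
  obtain ⟨p, q, hpp, -, -, htail, -, hmin, -⟩ := hpt
  have hsymm : pmin ≤ 1 ∨ ∀ ξ, (f ξ).im = 0 := by
    by_cases h : IsSymmetricMeasure V ∧ m = 0
    · exact Or.inr (hf.im_eq_zero h.1 h.2)
    · refine Or.inl ((hmin ?_).trans_le (min_le_right _ _))
      tauto
  refine ⟨hQ, hf.lintegral_rpow_lt_top hp hp2 (htail.mono hpp) hsymm hτ hQf,
    hsymm.imp_right fun h ξ => ?_⟩
  rw [hQf, Complex.exp_im, Complex.im_ofReal_mul, h, mul_zero, Real.sin_zero, mul_zero]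

namespace IsAdmissibleJumpLaw

variable {p : ℝ}

theorem isPTriplet (h : IsAdmissibleJumpLaw p J) {pmax : ℝ} (hpmax : p ≤ pmax) :
    IsPTriplet p pmax (impulsiveDrift r J) 0 (impulsiveLevyMeasure r J) := by
  have := h.isProbabilityMeasure
  refine ⟨p, p, le_rfl, le_rfl, hpmax, finiteTailMoment_impulsiveLevyMeasure h.moment,
    finiteLocalMoment_impulsiveLevyMeasure h.moment, fun hns => ?_, fun h0 => absurd rfl h0⟩
  rcases h.symm with hp1 | him
  · exact (min_eq_left hp1).symm
  · have hJ := isSymmetricMeasure_of_charFun_im_eq_zero him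
    exact absurd hns (not_or.2
      ⟨not_not.2 hJ.impulsiveLevyMeasure, not_not.2 hJ.impulsiveDrift_eq_zero⟩)

/-- The exponent of the compound Poisson law with jumps `J` is the impulsive exponent of `J`, so the
moment criterion for infinitely divisible laws applies to it. -/
theorem compoundPoissonLaw (h : IsAdmissibleJumpLaw p J) (hp : 0 < p) (hp2 : p ≤ 2) (hr : 0 ≤ r) :
    IsAdmissibleJumpLaw p (compoundPoissonLaw r J) := by
  have := h.isProbabilityMeasure
  have := isProbabilityMeasure_compoundPoissonLaw hr J
  refine (h.isPTriplet le_rfl).isAdmissibleJumpLaw (isLevyTriplet_impulsiveExponent hr) hp hp2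
    zero_le_one fun ξ => ?_
  rw [charFun_compoundPoissonLaw hr, Complex.ofReal_one, one_mul, impulsiveExponent]

theorem isJumpLaw (h : IsAdmissibleJumpLaw p J) (hp : 0 < p) : IsJumpLaw J :=
  ⟨h.isProbabilityMeasure, p, hp, h.moment⟩

theorem isSchwartzLevyExponent (h : IsAdmissibleJumpLaw p J) (hp : 0 < p) (hr : 0 ≤ r) :
    IsSchwartzLevyExponent (impulsiveExponent r J) :=
  have := h.isProbabilityMeasure
  ⟨isLevyExponent_impulsiveExponent hr, _, _, _, isLevyTriplet_impulsiveExponent hr, p, hp,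
    finiteTailMoment_impulsiveLevyMeasure h.moment⟩

theorem compatibilityConditions {d : ℕ} {L : Sch d →L[ℝ] Temp d} (h : IsAdmissibleJumpLaw p J)
    (hp : 0 < p) {pmax : ℝ} (hpmax : p ≤ pmax) (hpmax2 : pmax ≤ 2) (hr : 0 ≤ r)
    (hL : HasStableLeftInverse L p pmax) :
    CompatibilityConditions L (impulsiveExponent r J) :=
  have := h.isProbabilityMeasure
  ⟨p, pmax, hp, hpmax, hpmax2,
    ⟨_, _, _, isLevyTriplet_impulsiveExponent hr, h.isPTriplet hpmax⟩, hL⟩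

end IsAdmissibleJumpLaw

theorem IsImpulsiveNoise.isLevyWhiteNoise {d : ℕ} {Ω : Type*} [MeasurableSpace Ω] {μ : Measure Ω}
    {w : Ω → Temp d} (h : IsImpulsiveNoise μ w r J)
    (hf : IsSchwartzLevyExponent (impulsiveExponent r J)) :
    IsLevyWhiteNoise μ w (impulsiveExponent r J) := by
  refine ⟨h.1, hf, fun φ => ?_⟩
  have := h.2.2.1.1
  rw [h.2.2.2 φ, ← integral_const_mul]
  congr 2
  funext x
  have hexp : Integrable (fun t : ℝ => Complex.exp (Complex.I * (φ x : ℝ) * t)) J := by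
    refine (integrable_const (1 : ℝ)).mono' (by fun_prop) (.of_forall fun t => ?_)
    rw [mul_assoc, ← Complex.ofReal_mul, Complex.norm_exp_I_mul_ofReal]
  rw [integral_sub hexp (integrable_const 1), impulsiveExponent, charFun_apply_real]
  simp only [integral_const, probReal_univ, one_smul]
  congr 3
  funext t
  ring_nf

end JumpLaw

end LevyCompat

/-- Compatibility of `(L, w)` includes that `L` is spline-admissible and that `w` is a Lévy white noise
with Lévy exponent `f`. `Q` below is the infinitely divisible law with Lévy exponent `τ f`, and `compoundPoissonLaw 1 Q`
is the compound Poisson law of rate `1` with law of jumps `Q`. The claim is made for impulsive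
noises with either of these laws of jumps. -/
theorem mainTheorem5 {d : ℕ} {Ω : Type*} [MeasurableSpace Ω]
    (L : LevyCompat.Sch d →L[ℝ] LevyCompat.Temp d)
    (μ : Measure Ω) (w : Ω → LevyCompat.Temp d) (f : ℝ → ℂ)
    (hcomp : LevyCompat.IsCompatible L μ w f)
    (lam τ : ℝ) (hlam : 0 < lam) (hτ : 0 < τ) :
    (∃! Q : Measure ℝ, LevyCompat.IsInfDivLaw (fun ξ => τ * f ξ) Q) ∧
    ∀ Q : Measure ℝ, LevyCompat.IsInfDivLaw (fun ξ => τ * f ξ) Q →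
      ∀ J : Measure ℝ, (J = Q ∨ J = LevyCompat.compoundPoissonLaw 1 Q) →
        LevyCompat.IsJumpLaw J ∧
        LevyCompat.IsSchwartzLevyExponent (LevyCompat.impulsiveExponent lam J) ∧
        LevyCompat.CompatibilityConditions L (LevyCompat.impulsiveExponent lam J) ∧
        ∀ {Ω' : Type*} [MeasurableSpace Ω'] (μ' : Measure Ω') (w' : Ω' → LevyCompat.Temp d),
          LevyCompat.IsImpulsiveNoise μ' w' lam J →
            LevyCompat.IsCompatible L μ' w' (LevyCompat.impulsiveExponent lam J) := by
  obtain ⟨hL, ⟨-, ⟨hf, -⟩, -⟩, pmin, pmax, hp, hpp, hp2, ⟨m, s, V, htrip, hpt⟩, hinv⟩ := hcomp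
  refine ⟨LevyCompat.existsUnique_isInfDivLaw_mul hf hτ.le, fun Q hQ J hJ => ?_⟩
  have hQprob := hQ.1.1
  have hadmQ : LevyCompat.IsAdmissibleJumpLaw pmin Q :=
    hpt.isAdmissibleJumpLaw htrip hp (hpp.trans hp2) hτ.le hQ.2
  have hadm : LevyCompat.IsAdmissibleJumpLaw pmin J := by
    rcases hJ with rfl | rfl
    · exact hadmQ
    · exact hadmQ.compoundPoissonLaw hp (hpp.trans hp2) zero_le_one
  have hS := hadm.isSchwartzLevyExponent hp hlam.le
  have hC := hadm.compatibilityConditions hp hpp hp2 hlam.le hinv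
  exact ⟨hadm.isJumpLaw hp, hS, hC, fun μ' w' hw' => ⟨hL, hw'.isLevyWhiteNoise hS, hC⟩⟩
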